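/- **Setting.** Let $Var$ be a set of quantum variables (for instance a countably infinite one), each of type $\mathbf{Boolean}$ or $\mathbf{integer}$. The state space $\mathcal H_q$ of a variable $q$ is the Hilbert space with orthonormal basis $\{|0\rangle,|1\rangle\}$ if $q$ is Boolean and $\{|n\rangle:n\in\mathbb Z\}$ if $q$ is of integer type. A register $\bar q$ is a finite sequence of distinct variables, and $\mathcal H_{\bar q}$ is the tensor product of their state spaces. The space $\mathcal H_{\rm all}$ is the Hilbert space with orthonormal basis $\mathcal B$, where $\mathcal B$ is a non-empty set of product vectors $\bigotimes_{q}|c_q\rangle$ of computational basis vectors, closed under changing finitely many $c_q$ (for instance all product vectors, or those with $c_q=0$ for all but finitely many $q$). Operators on $\mathcal H_{\bar q}$ are identified with their cylinder extensions $A\otimes I$ on $\mathcal H_{\rm all}$. All operators are bounded. A partial density operator is a positive trace class operator $\rho$ on $\mathcal H_{\rm all}$ with $\mathrm{tr}\,\rho\le1$; a quantum predicate is an operator $P$ on $\mathcal H_{\rm all}$ with $0\sqsubseteq P\sqsubseteq I$, where $\sqsubseteq$ is the Löwner order. **Programs.** Programs are generated by $$S::=\mathbf{skip}\mid q:=0\mid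 \bar q:=U\bar q\mid S_1;S_2\mid \mathbf{measure}\ M[\bar q]:\bar S\mid \mathbf{while}\ M[\bar q]=1\ \mathbf{do}\ S,$$ where $U$ is an operator on $\mathcal H_{\bar q}$ with $U^\dagger U=I$ (in particular, any unitary operator), $M=\{M_m\}$ is a (finite or infinite) measurement on $\mathcal H_{\bar q}$, i.e. $\sum_mM_m^\dagger M_m=I$ in the strong operator topology, $\bar S=\{S_m\}$ has one program for each outcome $m$, and $M=\{M_0,M_1\}$ in the loop. **Semantics.** With $E$ the empty program and the convention $E;S_2=S_2$, the transitions between configurations are: $\langle\mathbf{skip},\rho\rangle\to\langle E,\rho\rangle$; $\langle q:=0,\rho\rangle\to\langle E,\sum_x|0\rangle_q\langle x|\rho|x\rangle_q\langle0|\rangle$, with $x$ ranging over the basis labels of $q$; $\langle\bar q:=U\bar q,\rho\rangle\to\langle E,U\rho U^\dagger\rangle$; $\langle S_1;S_2,\rho\rangle\to\langle S_1';S_2,\rho'\rangle$ whenever $\langle S_1,\rho\rangle\to\langle S_1',\rho'\rangle$; $\langle\mathbf{measure}\ M[\bar q]:\bar S,\rho\rangle\to\langle S_m,M_m\rho M_m^\dagger\rangle$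 for each outcome $m$; and, for $W=\mathbf{while}\ M[\bar q]=1\ \mathbf{do}\ S$, $\langle W,\rho\rangle\to\langle E,M_0\rho M_0^\dagger\rangle$ and $\langle W,\rho\rangle\to\langle S;W,M_1\rho M_1^\dagger\rangle$. For a partial density operator $\rho$ let $[\![S]\!]\rho$ be the sum of the multiset of all $\rho'$ with $\langle S,\rho\rangle\to^*\langle E,\rho'\rangle$, counted once for each terminating computation, where different measurement outcomes give different computations. **Proof system $qPD$.** A correctness formula is $\{P\}S\{Q\}$ with a program $S$ and quantum predicates $P,Q$. The formulas derivable in $qPD$ are those obtained from the following axioms and rules (in which all $P,P_m,P',Q,Q',R$ are quantum predicates; infinite sums are taken in the strong operator topology): * $\{P\}\,\mathbf{skip}\,\{P\}$; * $\{\sum_x|x\rangle_q\langle0|P|0\rangle_q\langle x|\}\;q:=0\;\{P\}$; * $\{U^\dagger PU\}\;\bar q:=U\bar q\;\{P\}$; * from $\{P\}S_1\{Q\}$ and $\{Q\}S_2\{R\}$ infer $\{P\}S_1;S_2\{R\}$; * from $\{P_m\}S_m\{Q\}$ for all $m$ infer $\{\sum_mM_m^\dagger P_mM_m\}\;\mathbf{measure}\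 M[\bar q]:\bar S\;\{Q\}$; * from $\{Q\}S\{M_0^\dagger PM_0+M_1^\dagger QM_1\}$ infer $\{M_0^\dagger PM_0+M_1^\dagger QM_1\}\;\mathbf{while}\ M[\bar q]=1\ \mathbf{do}\ S\;\{P\}$; * from $P\sqsubseteq P'$, $\{P'\}S\{Q'\}$ and $Q'\sqsubseteq Q$ infer $\{P\}S\{Q\}$. **Theorem (soundness of $qPD$).** For every program $S$ and every partial density operator $\rho$, the sum that defines $[\![S]\!]\rho$ converges in operator norm and $[\![S]\!]\rho$ is a partial density operator. If $\{P\}S\{Q\}$ is derivable in $qPD$, then it is true in the sense of partial correctness: for all partial density operators $\rho$ on $\mathcal H_{\rm all}$, $$\mathrm{tr}(P\rho)\le\mathrm{tr}(Q[\![S]\!]\rho)+[\mathrm{tr}(\rho)-\mathrm{tr}([\![S]\!]\rho)].$$ -/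

import Mathlib

open scoped ComplexOrder

universe u

namespace QWhile

/-- The two basic types of quantum variables. -/
inductive QType where
  | boolean
  | integer

/-- The labels of the computational basis of the state space of a type:
`|0⟩, |1⟩` for `boolean`, and `|n⟩` with `n ∈ ℤ` for `integer`. -/
def QType.Label : QType → Type
  | .boolean => Fin 2
  | .integer => ℤ

/-- The label of the basis state `|0⟩`. -/
def QType.zero : (t : QType) → t.Label
  | .boolean => (0 : Fin 2)
  | .integer => (0 : ℤ)

/-- The Hilbert space `ℓ²(ι)` of square summable complex families, i.e. the Hilbert space
with the orthonormal basis `|i⟩`, `i ∈ ι`. -/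
abbrev L2 (ι : Type*) : Type _ := lp (fun _ : ι => ℂ) 2

/-- The basis vector `|i⟩`. -/
noncomputable def ket {ι : Type*} (i : ι) : L2 ι :=
  letI := Classical.decEq ι
  lp.single 2 i (1 : ℂ)

/-- A quantum register: a finite sequence of distinct variables. -/
structure Register (Var : Type u) where
  vars : List Var
  nodup : vars.Nodup

/-- The register that consists of the single variable `q`. -/
def Register.single {Var : Type u} (q : Var) : Register Var := ⟨[q], List.nodup_singleton q⟩

/-- Labels of the product basis of the state space of a register. -/
abbrev Register.Label {Var : Type u} (type : Var → QType) (r : Register Var) : Type u :=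
  ∀ q : {q : Var // q ∈ r.vars}, (type q.1).Label

/-- The state space of a register: the tensor product of the state spaces of its variables,
i.e. the Hilbert space with the product basis. -/
abbrev RegSpace {Var : Type u} (type : Var → QType) (r : Register Var) : Type u :=
  L2 (r.Label type)

/-- A set of product basis vectors `⨂_q |c q⟩` that spans a tensor product of the state spaces
of all variables: it is non-empty and closed under changing `c` at finitely many variables. -/
structure GlobalBasis {Var : Type u} (type : Var → QType) where
  carrier : Set (∀ q, (type q).Label)
  nonempty : carrier.Nonempty
  closed : ∀ c ∈ carrier, ∀ c' : ∀ q, (type q).Label, {q | c' q ≠ c q}.Finite → c' ∈ carrier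

/-- All product basis vectors (the complete tensor product). -/
def GlobalBasis.full {Var : Type u} (type : Var → QType) : GlobalBasis type where
  carrier := Set.univ
  nonempty := ⟨fun q => (type q).zero, trivial⟩
  closed := fun _ _ _ _ => trivial

/-- The product basis vectors which are `|0⟩` at all but finitely many variables; a countable
set if there are countably many variables. -/
def GlobalBasis.almostZero {Var : Type u} (type : Var → QType) : GlobalBasis type where
  carrier := {c | {q | c q ≠ (type q).zero}.Finite}
  nonempty := ⟨fun q => (type q).zero, by simp⟩
  closed := by
    intro c hc c' h
    refine (hc.union h).subset fun q hq => ?_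
    by_cases h1 : c' q = c q
    · exact Or.inl (by simpa [h1] using hq)
    · exact Or.inr h1

section

variable {Var : Type u} {type : Var → QType}

/-- The state space `H_all` of all quantum variables. -/
abbrev GlobalBasis.Space (B : GlobalBasis type) : Type u := L2 B.carrier

/-- Bounded operators on `H_all`. -/
abbrev Op (B : GlobalBasis type) : Type u := B.Space →L[ℂ] B.Space

/-! The cylinder extension of an operator on the state space of a register. -/

/-- The part of the basis label `c` at the variables of `r`. -/
def readReg {B : GlobalBasis type} (r : Register Var) (c : B.carrier) : r.Label type :=
  fun q => c.1 q.1

open Classical in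
/-- The basis label `c`, overwritten by `x` at the variables of `r`. -/
noncomputable def writeReg {B : GlobalBasis type} (r : Register Var) (x : r.Label type)
    (c : B.carrier) : B.carrier :=
  ⟨fun q => if h : q ∈ r.vars then x ⟨q, h⟩ else c.1 q, by
    refine B.closed c.1 c.2 _ ((r.vars.finite_toSet).subset fun q hq => ?_)
    by_contra h
    exact hq (dif_neg h)⟩

theorem readReg_writeReg {B : GlobalBasis type} (r : Register Var) (x : r.Label type)
    (c : B.carrier) : readReg r (writeReg r x c) = x := by
  funext q
  simp [readReg, writeReg, q.2]

theorem writeReg_readReg {B : GlobalBasis type} (r : Register Var)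
    (c : B.carrier) : writeReg r (readReg r c) c = c := by
  apply Subtype.ext
  funext q
  simp [readReg, writeReg]

theorem writeReg_writeReg {B : GlobalBasis type} (r : Register Var) (x y : r.Label type)
    (c : B.carrier) : writeReg r x (writeReg r y c) = writeReg r x c := by
  apply Subtype.ext
  funext q
  by_cases h : q ∈ r.vars <;> simp [writeReg, h]

theorem writeReg_injective {B : GlobalBasis type} (r : Register Var) (c : B.carrier) :
    Function.Injective fun x => writeReg r x c := by
  intro x y h
  have h2 := congrArg (readReg r) h
  simpa only [readReg_writeReg] using h2

theorem hasSum_sq {ι : Type*} (f : L2 ι) : HasSum (fun i => ‖f i‖ ^ 2) (‖f‖ ^ 2) := by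
  have h := lp.hasSum_norm (p := 2) (by norm_num) f
  simpa using h

theorem memLp_two {ι : Type*} {f : ι → ℂ} (h : Summable fun i => ‖f i‖ ^ 2) :
    Memℓp f 2 := by
  apply memℓp_gen
  simpa using h

/-- The coefficients of `f` on the basis vectors that agree with `c` outside `r`. -/
noncomputable def slice {B : GlobalBasis type} (r : Register Var) (f : B.Space)
    (c : B.carrier) : RegSpace type r :=
  ⟨fun x => f (writeReg r x c), memLp_two
    ((hasSum_sq f).summable.comp_injective (writeReg_injective r c))⟩

theorem slice_writeReg {B : GlobalBasis type} (r : Register Var) (f : B.Space)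
    (x : r.Label type) (c : B.carrier) : slice r f (writeReg r x c) = slice r f c := by
  apply lp.ext
  funext y
  simp [slice, writeReg_writeReg]

/-- A basis label is given by its part at `r` and its part outside `r`. -/
noncomputable def splitEquiv (B : GlobalBasis type) (r : Register Var) (x₀ : r.Label type) :
    B.carrier ≃ {c : B.carrier // readReg r c = x₀} × r.Label type where
  toFun c := (⟨writeReg r x₀ c, readReg_writeReg r x₀ c⟩, readReg r c)
  invFun p := writeReg r p.2 p.1.1
  left_inv c := by simp [writeReg_writeReg, writeReg_readReg]
  right_inv p := by
    obtain ⟨⟨d, hd⟩, x⟩ := p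
    simp only [Prod.mk.injEq, Subtype.mk.injEq, writeReg_writeReg, readReg_writeReg, and_true]
    rw [← hd, writeReg_readReg]

theorem hasSum_slice {B : GlobalBasis type} (r : Register Var) (x₀ : r.Label type)
    (f : B.Space) :
    HasSum (fun d : {c : B.carrier // readReg r c = x₀} => ‖slice r f d.1‖ ^ 2) (‖f‖ ^ 2) := by
  have h := (splitEquiv B r x₀).symm.hasSum_iff.mpr (hasSum_sq f)
  exact HasSum.prod_fiberwise h fun d => hasSum_sq (slice r f d.1)

theorem cylinder_aux {B : GlobalBasis type} (r : Register Var)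
    (A : RegSpace type r →L[ℂ] RegSpace type r) (f : B.Space) :
    ∃ s ≤ (‖A‖ * ‖f‖) ^ 2,
      HasSum (fun c : B.carrier => ‖A (slice r f c) (readReg r c)‖ ^ 2) s := by
  let x₀ : r.Label type := fun q => (type q.1).zero
  have hf := hasSum_slice r x₀ f
  have hle : ∀ d : {c : B.carrier // readReg r c = x₀},
      ‖A (slice r f d.1)‖ ^ 2 ≤ ‖A‖ ^ 2 * ‖slice r f d.1‖ ^ 2 := fun d => by
    rw [← mul_pow]
    exact pow_le_pow_left₀ (norm_nonneg _) (A.le_opNorm _) 2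
  have hA : Summable fun d : {c : B.carrier // readReg r c = x₀} => ‖A (slice r f d.1)‖ ^ 2 :=
    Summable.of_nonneg_of_le (fun _ => by positivity) hle (hf.summable.mul_left _)
  have hfib : ∀ d : {c : B.carrier // readReg r c = x₀},
      HasSum (fun x => ‖A (slice r f d.1) x‖ ^ 2) (‖A (slice r f d.1)‖ ^ 2) :=
    fun d => hasSum_sq _
  have hprod : Summable fun p : {c : B.carrier // readReg r c = x₀} × r.Label type =>
      ‖A (slice r f p.1.1) p.2‖ ^ 2 := by
    refine (summable_prod_of_nonneg fun _ => by positivity).mpr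
      ⟨fun d => (hfib d).summable, ?_⟩
    simpa only [(hfib _).tsum_eq] using hA
  have h1 := hprod.hasSum
  have h2 := h1.prod_fiberwise hfib
  refine ⟨∑' p : {c : B.carrier // readReg r c = x₀} × r.Label type,
    ‖A (slice r f p.1.1) p.2‖ ^ 2, ?_, (splitEquiv B r x₀).symm.hasSum_iff.mp ?_⟩
  · rw [mul_pow]
    exact hasSum_le hle h2 (hf.mul_left _)
  · convert h1 using 1
    funext p
    simp [splitEquiv, slice_writeReg, readReg_writeReg]

/-- The cylinder extension as a linear map. -/
noncomputable def cylinderLin {B : GlobalBasis type} (r : Register Var)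
    (A : RegSpace type r →L[ℂ] RegSpace type r) : B.Space →ₗ[ℂ] B.Space where
  toFun f := ⟨fun c => A (slice r f c) (readReg r c), memLp_two
    (cylinder_aux r A f).choose_spec.2.summable⟩
  map_add' f g := by
    apply lp.ext
    funext c
    have h : slice r (f + g) c = slice r f c + slice r g c := rfl
    change A (slice r (f + g) c) (readReg r c) =
      A (slice r f c) (readReg r c) + A (slice r g c) (readReg r c)
    rw [h, map_add]
    rfl
  map_smul' a f := by
    apply lp.ext
    funext c
    have h : slice r (a • f) c = a • slice r f c := rfl
    change A (slice r (a • f) c) (readReg r c) = a • A (slice r f c) (readReg r c)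
    rw [h, map_smul]
    rfl

theorem norm_cylinderLin_le {B : GlobalBasis type} (r : Register Var)
    (A : RegSpace type r →L[ℂ] RegSpace type r) (f : B.Space) :
    ‖cylinderLin r A f‖ ≤ ‖A‖ * ‖f‖ := by
  obtain ⟨s, hs, h⟩ := cylinder_aux r A f
  have h2 : ‖cylinderLin r A f‖ ^ 2 = s := (hasSum_sq (cylinderLin r A f)).unique h
  exact (sq_le_sq₀ (norm_nonneg _) (by positivity)).mp (h2.trans_le hs)

/-- The cylinder extension `A ⊗ I` on `H_all` of an operator `A` on the state space of the
register `r`: it acts as `A` on the coordinates in `r` and leaves the others unchanged. -/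
noncomputable def cylinder (B : GlobalBasis type) (r : Register Var)
    (A : RegSpace type r →L[ℂ] RegSpace type r) : Op B :=
  (cylinderLin r A).mkContinuous ‖A‖ (norm_cylinderLin_le r A)

/-- The label `x` of the variable `q`, as a label of the one-variable register `q`. -/
def Register.singleLabel (q : Var) (x : (type q).Label) : (Register.single q).Label type :=
  fun p => cast (by rw [List.mem_singleton.mp p.2]) x

/-- The operator `|x⟩_q⟨y|` on `H_all`. -/
noncomputable def ketBra (B : GlobalBasis type) (q : Var) (x y : (type q).Label) : Op B :=
  cylinder B (Register.single q) (InnerProductSpace.rankOne ℂ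
    (ket (Register.singleLabel q x)) (ket (Register.singleLabel q y)))

/-! States and predicates. -/

/-- The trace `∑ ⟨c|A|c⟩`, computed in the product basis. -/
noncomputable def trace {B : GlobalBasis type} (A : Op B) : ℂ :=
  ∑' c : B.carrier, inner ℂ (ket c) (A (ket c))

/-- Partial density operators: positive trace class operators of trace at most one. -/
structure IsPartialDensity {B : GlobalBasis type} (ρ : Op B) : Prop where
  isPositive : ρ.IsPositive
  summable : Summable fun c : B.carrier => inner ℂ (ket c) (ρ (ket c))
  trace_le_one : trace ρ ≤ 1

/-- Quantum predicates on `H_all`: `0 ⊑ P ⊑ I` in the Löwner order. -/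
def Predicate (B : GlobalBasis type) : Type u := {P : Op B // 0 ≤ P ∧ P ≤ 1}

/-- The family `A` of operators sums to `T` in the strong operator topology. -/
def HasStrongSum {H : Type*} [NormedAddCommGroup H] [InnerProductSpace ℂ H] {I : Type*}
    (A : I → H →L[ℂ] H) (T : H →L[ℂ] H) : Prop :=
  ∀ ψ : H, HasSum (fun i => A i ψ) (T ψ)

/-- A quantum measurement with outcomes in `I` on the state space of the register `r`:
operators `M m` with `∑ (M m)† (M m) = Id`. -/
structure Measurement (type : Var → QType) (r : Register Var) (I : Type) : Type u where
  op : I → RegSpace type r →L[ℂ] RegSpace type r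
  complete : HasStrongSum (fun m => (op m).adjoint * op m) 1

/-- Quantum programs. `loop r M S` is the program `while M[r] = 1 do S`. -/
inductive Program (type : Var → QType) : Type (max u 1) where
  | skip : Program type
  | init (q : Var) : Program type
  | unitary (r : Register Var) (U : RegSpace type r →L[ℂ] RegSpace type r)
      (hU : U.adjoint * U = 1) : Program type
  | seq (S₁ S₂ : Program type) : Program type
  | measure (r : Register Var) {I : Type} (M : Measurement type r I) (S : I → Program type) :
      Program type
  | loop (r : Register Var) (M : Measurement type r (Fin 2)) (S : Program type) : Program type

/-- Sequential composition after a program or the empty program `E = none`, with `E; S₂ = S₂`. -/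
def Program.after : Option (Program type) → Program type → Program type
  | none, S₂ => S₂
  | some S₁, S₂ => .seq S₁ S₂

/-- The transitions `⟨S, ρ⟩ → ⟨S', ρ'⟩` of the operational semantics, where `S' = none` is the
empty program `E`. This is a family of types, not of propositions, since different outcomes of a
measurement can lead to the same configuration and have to be counted separately. -/
inductive Step (B : GlobalBasis type) :
    Program type → Op B → Option (Program type) → Op B → Type (max u 1) where
  | skip (ρ : Op B) : Step B .skip ρ none ρ
  | init (q : Var) (ρ ρ' : Op B)
      (h : HasSum (fun x => ketBra B q (type q).zero x * ρ * ketBra B q x (type q).zero) ρ') :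
      Step B (.init q) ρ none ρ'
  | unitary (r : Register Var) (U : RegSpace type r →L[ℂ] RegSpace type r)
      (hU : U.adjoint * U = 1) (ρ : Op B) :
      Step B (.unitary r U hU) ρ none (cylinder B r U * ρ * (cylinder B r U).adjoint)
  | seq (S₁ S₂ : Program type) (ρ : Op B) (S₁' : Option (Program type)) (ρ' : Op B)
      (h : Step B S₁ ρ S₁' ρ') : Step B (.seq S₁ S₂) ρ (some (Program.after S₁' S₂)) ρ'
  | measure (r : Register Var) {I : Type} (M : Measurement type r I) (S : I → Program type)
      (ρ : Op B) (m : I) :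
      Step B (.measure r M S) ρ (some (S m))
        (cylinder B r (M.op m) * ρ * (cylinder B r (M.op m)).adjoint)
  | loop_zero (r : Register Var) (M : Measurement type r (Fin 2)) (S : Program type) (ρ : Op B) :
      Step B (.loop r M S) ρ none
        (cylinder B r (M.op 0) * ρ * (cylinder B r (M.op 0)).adjoint)
  | loop_one (r : Register Var) (M : Measurement type r (Fin 2)) (S : Program type) (ρ : Op B) :
      Step B (.loop r M S) ρ (some (.seq S (.loop r M S)))
        (cylinder B r (M.op 1) * ρ * (cylinder B r (M.op 1)).adjoint)

/-- The terminating computations `⟨S, ρ⟩ →* ⟨E, ρ'⟩`. -/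
inductive Run (B : GlobalBasis type) :
    Option (Program type) → Op B → Op B → Type (max u 1) where
  | done (ρ : Op B) : Run B none ρ ρ
  | step (S : Program type) (ρ : Op B) (S' : Option (Program type)) (ρ' σ : Op B)
      (h : Step B S ρ S' ρ') (t : Run B S' ρ' σ) : Run B (some S) ρ σ

/-- The terminating computations of `S` from `ρ`, with their results: the index type of the
multi-set of the results. -/
def Computation {B : GlobalBasis type} (S : Program type) (ρ : Op B) : Type (max u 1) :=
  Σ ρ' : Op B, Run B (some S) ρ ρ'

/-- The denotational semantics `⟦S⟧ρ`: the sum of the results of all terminating computations. -/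
noncomputable def denote {B : GlobalBasis type} (S : Program type) (ρ : Op B) : Op B :=
  ∑' c : Computation S ρ, c.1

/-- The formula `{P} S {Q}` is true in the sense of partial correctness. -/
def PartiallyCorrect {B : GlobalBasis type} (P : Predicate B) (S : Program type)
    (Q : Predicate B) : Prop :=
  ∀ ρ : Op B, IsPartialDensity ρ →
    trace (P.1 * ρ) ≤ trace (Q.1 * denote S ρ) + (trace ρ - trace (denote S ρ))

/-- Derivability of the formula `{P} S {Q}` in the proof system `qPD`. -/
inductive Derivable {B : GlobalBasis type} :
    Predicate B → Program type → Predicate B → Prop where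
  | skip (P : Predicate B) : Derivable P .skip P
  | init (q : Var) (P R : Predicate B)
      (hR : HasStrongSum
        (fun x => ketBra B q x (type q).zero * P.1 * ketBra B q (type q).zero x) R.1) :
      Derivable R (.init q) P
  | unitary (r : Register Var) (U : RegSpace type r →L[ℂ] RegSpace type r)
      (hU : U.adjoint * U = 1) (P R : Predicate B)
      (hR : R.1 = (cylinder B r U).adjoint * P.1 * cylinder B r U) :
      Derivable R (.unitary r U hU) P
  | seq (S₁ S₂ : Program type) (P Q R : Predicate B) (h₁ : Derivable P S₁ Q)
      (h₂ : Derivable Q S₂ R) : Derivable P (.seq S₁ S₂) R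
  | measure (r : Register Var) {I : Type} (M : Measurement type r I) (S : I → Program type)
      (P : I → Predicate B) (Q R : Predicate B) (h : ∀ m, Derivable (P m) (S m) Q)
      (hR : HasStrongSum
        (fun m => (cylinder B r (M.op m)).adjoint * (P m).1 * cylinder B r (M.op m)) R.1) :
      Derivable R (.measure r M S) Q
  | loop (r : Register Var) (M : Measurement type r (Fin 2)) (S : Program type)
      (P Q R : Predicate B)
      (hR : R.1 = (cylinder B r (M.op 0)).adjoint * P.1 * cylinder B r (M.op 0) +
        (cylinder B r (M.op 1)).adjoint * Q.1 * cylinder B r (M.op 1))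
      (h : Derivable Q S R) : Derivable R (.loop r M S) P
  | order (S : Program type) (P P' Q' Q : Predicate B) (hP : P.1 ≤ P'.1)
      (h : Derivable P' S Q') (hQ : Q'.1 ≤ Q.1) : Derivable P S Q

end

end QWhile

namespace QWhile

/-! Since tr(Pρ) + tr((1 - P)ρ) = tr ρ, partial correctness rearranges to tr((1 - Q)⟦S⟧ρ) ≤ tr((1 -
P)ρ): the weight of failing the predicate does not grow. All terms are nonnegative, so traces are
taken in [0, ∞] (`posTrace`), where sums may be exchanged freely and no convergence is needed in
advance.

The failure weight is conserved by a measurement or another family K with ∑ K†K = I, because ∑ K†(1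
- P)K = 1 - ∑ K†PK (`posTrace_kraus`). Hence the failure weights of all successors of a
configuration add up to at most that of any derivable precondition (`tsum_transition_le`, by
induction on the derivation). `failWeight`, the infimum over derivable preconditions, makes this a
statement about configurations, which iterates along computations of bounded length
(`tsum_runs_le`). Finite sets of computations have bounded length, so the bound passes to the full
sum; loops need no fixed-point argument.

For Q = 0 failure weight is the trace itself, and {0} S {0} is always derivable (`derivable_zero`).
This bounds the total trace of the results, which dominates their operator norms, so ⟦S⟧ρ converges.
-/

theorem hasSum_of_eq {I E : Type*} [AddCommMonoid E] [TopologicalSpace E] {f g : I → E} {a : E}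
    (h : ∀ i, g i = f i) (hf : HasSum f a) : HasSum g a :=
  (funext h : g = f) ▸ hf

/-! ### Quadratic forms and square roots of positive operators. -/

section Hilbert

variable {H : Type*} [NormedAddCommGroup H] [InnerProductSpace ℂ H]

/-- The quadratic form `⟨x|A|x⟩` of a positive operator, as an extended nonnegative real. -/
noncomputable def quadForm (A : H →L[ℂ] H) (x : H) : ENNReal :=
  ENNReal.ofReal (inner ℂ x (A x)).re

theorem ofReal_norm_sq {E : Type*} [SeminormedAddCommGroup E] (x : E) :
    ENNReal.ofReal (‖x‖ ^ 2) = ‖x‖ₑ ^ 2 := by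
  rw [ENNReal.ofReal_pow (norm_nonneg _), ofReal_norm]

theorem re_inner_nonneg {A : H →L[ℂ] H} (hA : 0 ≤ A) (x : H) : 0 ≤ (inner ℂ x (A x)).re :=
  ((ContinuousLinearMap.nonneg_iff_isPositive A).mp hA).re_inner_nonneg_right x

theorem quadForm_mono {A C : H →L[ℂ] H} (h : A ≤ C) (x : H) : quadForm A x ≤ quadForm C x := by
  apply ENNReal.ofReal_le_ofReal
  have h1 : 0 ≤ (inner ℂ x ((C - A) x)).re :=
    ((ContinuousLinearMap.le_def A C).mp h).re_inner_nonneg_right x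
  simp only [sub_apply, inner_sub_right, Complex.sub_re] at h1
  linarith

theorem inner_eq_ofReal_re {A : H →L[ℂ] H} (hA : 0 ≤ A) (x : H) :
    inner ℂ x (A x) = (((inner ℂ x (A x)).re : ℝ) : ℂ) := by
  have h := ((ContinuousLinearMap.nonneg_iff_isPositive A).mp hA).inner_nonneg_right x
  exact (RCLike.nonneg_iff_exists_ofReal.mp h).elim fun r hr => by rw [← hr.2]; simp

theorem nonneg_of_hasSum {I : Type*} {A : I → H →L[ℂ] H} {T : H →L[ℂ] H} (h : HasSum A T)
    (hA : ∀ i, 0 ≤ A i) : 0 ≤ T := by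
  rw [ContinuousLinearMap.nonneg_iff_isPositive,
    ContinuousLinearMap.isPositive_iff_complex]
  intro x
  have h1 : HasSum (fun i => inner ℂ (A i x) x) (inner ℂ (T x) x) := by
    have h2 := h.mapL ((ContinuousLinearMap.apply ℂ H x))
    have h3 := (h2.mapL (innerSL ℂ x)).star
    simpa using h3
  have h0 : ∀ i, 0 ≤ inner ℂ (A i x) x := fun i =>
    ((ContinuousLinearMap.nonneg_iff_isPositive _).mp (hA i)).inner_nonneg_left x
  have h4 : 0 ≤ inner ℂ (T x) x := h1.nonneg h0
  rw [Complex.nonneg_iff] at h4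
  refine ⟨?_, h4.1⟩
  apply Complex.ext <;> simp [← h4.2]

theorem quadForm_tsum {I : Type*} {A : I → H →L[ℂ] H} {T : H →L[ℂ] H}
    (h : HasStrongSum A T) (hA : ∀ i, 0 ≤ A i) (x : H) :
    ∑' i, quadForm (A i) x = quadForm T x := by
  have h1 : HasSum (fun i => (inner ℂ x (A i x)).re) (inner ℂ x (T x)).re :=
    Complex.hasSum_re ((h x).mapL (innerSL ℂ x))
  rw [quadForm, ← h1.tsum_eq,
    ENNReal.ofReal_tsum_of_nonneg (fun i => re_inner_nonneg (hA i) x) h1.summable]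
  rfl

theorem HasSum.hasStrongSum {I : Type*} {A : I → H →L[ℂ] H} {T : H →L[ℂ] H} (h : HasSum A T) :
    HasStrongSum A T :=
  fun x => h.mapL (ContinuousLinearMap.apply ℂ H x)

variable [CompleteSpace H]

theorem quadForm_adjoint_mul_self {H' : Type*} [NormedAddCommGroup H'] [InnerProductSpace ℂ H']
    [CompleteSpace H'] (T : H →L[ℂ] H') (x : H) :
    quadForm (T.adjoint ∘L T) x = ‖T x‖ₑ ^ 2 := by
  rw [quadForm, ContinuousLinearMap.comp_apply, ContinuousLinearMap.adjoint_inner_right,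
    inner_self_eq_norm_sq_to_K, ← ofReal_norm_sq]
  norm_cast

theorem nonneg_conj {A : H →L[ℂ] H} (hA : 0 ≤ A) (K : H →L[ℂ] H) : 0 ≤ K * A * K.adjoint :=
  (ContinuousLinearMap.nonneg_iff_isPositive _).mpr
    (((ContinuousLinearMap.nonneg_iff_isPositive A).mp hA).conj_adjoint K)

/-- The positive square root of an operator. -/
noncomputable def opSqrt (A : H →L[ℂ] H) : H →L[ℂ] H := CFC.sqrt A

theorem opSqrt_mul_self {A : H →L[ℂ] H} (hA : 0 ≤ A) : opSqrt A * opSqrt A = A :=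
  CFC.sqrt_mul_sqrt_self A hA

theorem opSqrt_nonneg (A : H →L[ℂ] H) : 0 ≤ opSqrt A := CFC.sqrt_nonneg A

theorem opSqrt_adjoint (A : H →L[ℂ] H) : (opSqrt A).adjoint = opSqrt A :=
  ((ContinuousLinearMap.nonneg_iff_isPositive _).mp (opSqrt_nonneg A)).isSelfAdjoint.adjoint_eq

theorem enorm_opSqrt_apply {A : H →L[ℂ] H} (hA : 0 ≤ A) (x : H) :
    ‖opSqrt A x‖ₑ ^ 2 = quadForm A x := by
  rw [← quadForm_adjoint_mul_self, opSqrt_adjoint]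
  exact congrArg (quadForm · x) (opSqrt_mul_self hA)

end Hilbert

/-! ### Hilbert-Schmidt norms and traces with values in [0, ∞]. -/

section HilbertSchmidt

variable {ι : Type*}

theorem inner_ket (i : ι) (f : L2 ι) : inner ℂ (ket i) f = f i := by
  classical
  rw [ket, lp.inner_single_left]
  simp

theorem norm_ket (i : ι) : ‖ket i‖ = 1 := by
  classical
  rw [ket, lp.norm_single (by norm_num)]
  simp

theorem tsum_enorm_sq (f : L2 ι) : ∑' i, ‖f i‖ₑ ^ 2 = ‖f‖ₑ ^ 2 := by
  have h := hasSum_sq f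
  rw [← ofReal_norm_sq, ← h.tsum_eq,
    ENNReal.ofReal_tsum_of_nonneg (fun _ => by positivity) h.summable]
  simp only [ofReal_norm_sq]

/-- The square of the Hilbert-Schmidt norm. -/
noncomputable def hsSq (A : L2 ι →L[ℂ] L2 ι) : ENNReal := ∑' i, ‖A (ket i)‖ₑ ^ 2

theorem enorm_apply_ket (A : L2 ι →L[ℂ] L2 ι) (i j : ι) :
    ‖A (ket i) j‖ₑ = ‖A.adjoint (ket j) i‖ₑ := by
  rw [← inner_ket, ← inner_ket, ContinuousLinearMap.adjoint_inner_right,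
    ← ofReal_norm, ← ofReal_norm, norm_inner_symm]

/-- By Parseval both sides are the double sum of the squared moduli of the matrix entries, read by
columns or by rows. -/
theorem hsSq_adjoint (A : L2 ι →L[ℂ] L2 ι) : hsSq A.adjoint = hsSq A := by
  simp only [hsSq, ← tsum_enorm_sq]
  rw [ENNReal.tsum_comm]
  simp only [enorm_apply_ket A]

/-- The coordinates of A x are ⟨A† e_i | x⟩; Cauchy-Schwarz bounds each, and their squares add up to
the Hilbert-Schmidt norm of A†. -/
theorem enorm_sq_le_hsSq (A : L2 ι →L[ℂ] L2 ι) : ‖A‖ₑ ^ 2 ≤ hsSq A := by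
  by_cases hA : hsSq A = ⊤
  · simp [hA]
  have key : ∀ x, ‖A x‖ₑ ^ 2 ≤ hsSq A * ‖x‖ₑ ^ 2 := by
    intro x
    rw [← tsum_enorm_sq, ← hsSq_adjoint, hsSq, ← ENNReal.tsum_mul_right]
    refine ENNReal.tsum_le_tsum fun i => ?_
    rw [← mul_pow, ← inner_ket, ← ContinuousLinearMap.adjoint_inner_left]
    gcongr
    rw [← ofReal_norm, ← ofReal_norm, ← ofReal_norm, ← ENNReal.ofReal_mul (norm_nonneg _)]
    exact ENNReal.ofReal_le_ofReal (norm_inner_le_norm _ _)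
  have h2 : ‖A‖ ≤ √(hsSq A).toReal := by
    refine A.opNorm_le_bound (Real.sqrt_nonneg _) fun x => ?_
    refine abs_le_of_sq_le_sq' ?_ (by positivity) |>.2
    rw [mul_pow, Real.sq_sqrt ENNReal.toReal_nonneg]
    have h3 := ENNReal.toReal_mono (by finiteness) (key x)
    simpa using h3
  rw [← ofReal_norm_sq]
  refine ENNReal.ofReal_le_of_le_toReal ?_
  rw [← Real.sq_sqrt (ENNReal.toReal_nonneg (a := hsSq A))]
  gcongr

theorem hsSq_mul_le (A C : L2 ι →L[ℂ] L2 ι) : hsSq (A * C) ≤ ‖A‖ₑ ^ 2 * hsSq C := by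
  rw [hsSq, hsSq, ← ENNReal.tsum_mul_left]
  refine ENNReal.tsum_le_tsum fun i => ?_
  rw [← mul_pow]
  gcongr
  exact A.le_opENorm _

theorem hasSum_of_hsSq {A : L2 ι →L[ℂ] L2 ι} (h : hsSq A ≠ ⊤) :
    HasSum (fun i => ((‖A (ket i)‖ : ℂ)) ^ 2) ((hsSq A).toReal : ℂ) := by
  have h1 := (ENNReal.summable_toReal h).hasSum
  rw [← ENNReal.tsum_toReal_eq (fun i => ENNReal.ne_top_of_tsum_ne_top h i)] at h1
  have h2 := Complex.hasSum_ofReal.mpr h1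
  simpa [hsSq] using h2

theorem hsSq_add_ne_top {A C : L2 ι →L[ℂ] L2 ι} (hA : hsSq A ≠ ⊤) (hC : hsSq C ≠ ⊤) :
    hsSq (A + C) ≠ ⊤ := by
  have h : hsSq (A + C) ≤ 2 * hsSq A + 2 * hsSq C := by
    simp only [hsSq, ← ENNReal.tsum_mul_left, ← ENNReal.tsum_add]
    refine ENNReal.tsum_le_tsum fun i => ?_
    have h2 : (2 : ENNReal) = ENNReal.ofReal 2 := (ENNReal.ofReal_ofNat 2).symm
    simp only [← ofReal_norm_sq, add_apply, h2]
    rw [← ENNReal.ofReal_mul (by norm_num),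
      ← ENNReal.ofReal_mul (by norm_num), ← ENNReal.ofReal_add (by positivity) (by positivity)]
    apply ENNReal.ofReal_le_ofReal
    nlinarith [norm_add_le (A (ket i)) (C (ket i)), norm_nonneg (A (ket i) + C (ket i)),
      sq_nonneg (‖A (ket i)‖ - ‖C (ket i)‖), norm_nonneg (A (ket i)), norm_nonneg (C (ket i))]
  exact ne_top_of_le_ne_top (by finiteness) h

theorem hsSq_smul_ne_top {A : L2 ι →L[ℂ] L2 ι} (hA : hsSq A ≠ ⊤) (a : ℂ) :
    hsSq (a • A) ≠ ⊤ := by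
  have h : hsSq (a • A) = ‖a‖ₑ ^ 2 * hsSq A := by
    simp only [hsSq, ← ENNReal.tsum_mul_left, smul_apply, enorm_smul, mul_pow]
  rw [h]
  finiteness

/-- The Hilbert-Schmidt inner product `tr(A†C)`, converging in the given basis. -/
theorem exists_hasSum_inner {A C : L2 ι →L[ℂ] L2 ι} (hA : hsSq A ≠ ⊤) (hC : hsSq C ≠ ⊤) :
    ∃ s : ℂ, HasSum (fun i => inner ℂ (A (ket i)) (C (ket i))) s ∧
      HasSum (fun i => inner ℂ (C.adjoint (ket i)) (A.adjoint (ket i))) s := by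
  have hC' : ∀ a : ℂ, hsSq (a • C) ≠ ⊤ := hsSq_smul_ne_top hC
  have h : ∀ a : ℂ, HasSum (fun i => ((‖(A + a • C) (ket i)‖ : ℂ)) ^ 2)
      ((hsSq (A + a • C)).toReal : ℂ) := fun a => hasSum_of_hsSq (hsSq_add_ne_top hA (hC' a))
  have h' : ∀ a : ℂ, HasSum (fun i => ((‖(A + a • C).adjoint (ket i)‖ : ℂ)) ^ 2)
      ((hsSq (A + a • C)).toReal : ℂ) := fun a => by
    rw [← hsSq_adjoint]
    exact hasSum_of_hsSq (by rw [hsSq_adjoint]; exact hsSq_add_ne_top hA (hC' a))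
  -- Polarization: s is built from `hsSq (A + a • C)` for a = ±1, ±i. These values do not change
  -- under adjoints, so both series have the same sum.
  refine ⟨((hsSq (A + (1 : ℂ) • C)).toReal - (hsSq (A + (-1 : ℂ) • C)).toReal +
    ((hsSq (A + (-Complex.I) • C)).toReal - (hsSq (A + Complex.I • C)).toReal) * Complex.I) / 4,
    ?_, ?_⟩
  · have h1 := (((h 1).sub (h (-1))).add
      (((h (-Complex.I)).sub (h Complex.I)).mul_right Complex.I)).div_const 4
    refine hasSum_of_eq (fun i => ?_) h1
    rw [inner_eq_sum_norm_sq_div_four]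
    simp [sub_eq_add_neg]
  · have h1 := (((h' 1).sub (h' (-1))).add
      (((h' (-Complex.I)).sub (h' Complex.I)).mul_right Complex.I)).div_const 4
    refine hasSum_of_eq (fun i => ?_) h1
    rw [inner_eq_sum_norm_sq_div_four]
    -- The adjoint conjugates i, and the second series has its arguments swapped; this identity
    -- shows that the two effects cancel.
    have e1 : ∀ x y : L2 ι, ‖x - Complex.I • y‖ = ‖y + Complex.I • x‖ := fun x y => by
      rw [← one_mul ‖y + _‖, ← Complex.norm_I, ← norm_smul, smul_add, smul_smul,
        Complex.I_mul_I, neg_one_smul, ← norm_neg]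
      congr 1; abel
    have e2 := e1 (A.adjoint (ket i)) (C.adjoint (ket i))
    have e3 : (Complex.I • C).adjoint = -(Complex.I • C.adjoint) := by
      rw [map_smulₛₗ, Complex.conj_I, neg_smul]
    simp [← sub_eq_add_neg, e3, e1 (C.adjoint _), ← e2, add_comm (C.adjoint (ket i)) (A.adjoint _),
      norm_sub_rev (C.adjoint (ket i)) (A.adjoint _)]

/-- The value of the trace `tr(Pρ)` of positive operators `P` and `ρ`. -/
noncomputable def posTrace (P ρ : L2 ι →L[ℂ] L2 ι) : ENNReal := hsSq (opSqrt P * opSqrt ρ)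

variable {P ρ : L2 ι →L[ℂ] L2 ι}

theorem posTrace_comm (P ρ : L2 ι →L[ℂ] L2 ι) : posTrace P ρ = posTrace ρ P := by
  have h : opSqrt ρ * opSqrt P = (opSqrt P * opSqrt ρ).adjoint := by
    rw [← ContinuousLinearMap.star_eq_adjoint, star_mul, ContinuousLinearMap.star_eq_adjoint,
      ContinuousLinearMap.star_eq_adjoint, opSqrt_adjoint, opSqrt_adjoint]
  rw [posTrace, posTrace, h, hsSq_adjoint]

/-- Here P enters only through its quadratic form, so monotonicity and additivity in P can be read
off; by symmetry the same holds for ρ. -/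
theorem posTrace_eq_left (hP : 0 ≤ P) (ρ : L2 ι →L[ℂ] L2 ι) :
    posTrace P ρ = ∑' i, quadForm P (opSqrt ρ (ket i)) := by
  simp only [← enorm_opSqrt_apply hP]
  rfl

theorem posTrace_eq_right (hρ : 0 ≤ ρ) (P : L2 ι →L[ℂ] L2 ι) :
    posTrace P ρ = ∑' i, quadForm ρ (opSqrt P (ket i)) := by
  rw [posTrace_comm, posTrace_eq_left hρ]

theorem posTrace_mono_left {P' : L2 ι →L[ℂ] L2 ι} (hP : 0 ≤ P) (h : P ≤ P')
    (ρ : L2 ι →L[ℂ] L2 ι) : posTrace P ρ ≤ posTrace P' ρ := by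
  rw [posTrace_eq_left hP, posTrace_eq_left (hP.trans h)]
  exact ENNReal.tsum_le_tsum fun i => quadForm_mono h _

theorem posTrace_tsum_left {I : Type*} {A : I → L2 ι →L[ℂ] L2 ι} (h : HasStrongSum A P)
    (hA : ∀ i, 0 ≤ A i) (hP : 0 ≤ P) (ρ : L2 ι →L[ℂ] L2 ι) :
    ∑' i, posTrace (A i) ρ = posTrace P ρ := by
  simp only [posTrace_eq_left (hA _), posTrace_eq_left hP]
  rw [ENNReal.tsum_comm]
  simp only [quadForm_tsum h hA]

theorem posTrace_tsum_right {I : Type*} {A : I → L2 ι →L[ℂ] L2 ι} (h : HasStrongSum A ρ)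
    (hA : ∀ i, 0 ≤ A i) (hρ : 0 ≤ ρ) (P : L2 ι →L[ℂ] L2 ι) :
    ∑' i, posTrace P (A i) = posTrace P ρ := by
  simp only [posTrace_comm P, posTrace_tsum_left h hA hρ]

theorem quadForm_conj (A K : L2 ι →L[ℂ] L2 ι) (x : L2 ι) :
    quadForm (K.adjoint * A * K) x = quadForm A (K x) := by
  rw [quadForm, quadForm, mul_apply_eq_comp, mul_apply_eq_comp,
    ContinuousLinearMap.adjoint_inner_right]

/-- Cyclicity of the trace: the two sides are the squared Hilbert-Schmidt norms of √ρ K† √P and of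
its adjoint √P K √ρ. The roots of the conjugated operators never appear. -/
theorem posTrace_conj (hP : 0 ≤ P) (hρ : 0 ≤ ρ) (K : L2 ι →L[ℂ] L2 ι) :
    posTrace P (K * ρ * K.adjoint) = posTrace (K.adjoint * P * K) ρ := by
  have hP' : 0 ≤ K.adjoint * P * K := by simpa using nonneg_conj hP K.adjoint
  have e : K * ρ * K.adjoint = K.adjoint.adjoint * ρ * K.adjoint := by simp
  rw [posTrace_eq_right (nonneg_conj hρ K), posTrace_eq_left hP', e]
  simp only [quadForm_conj, ← enorm_opSqrt_apply hP, ← enorm_opSqrt_apply hρ]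
  have h : opSqrt ρ * (K.adjoint * opSqrt P) = (opSqrt P * (K * opSqrt ρ)).adjoint := by
    rw [← ContinuousLinearMap.star_eq_adjoint (_ * _), star_mul, star_mul]
    simp only [ContinuousLinearMap.star_eq_adjoint, opSqrt_adjoint, mul_assoc]
  exact (congrArg hsSq h).trans (hsSq_adjoint _)

theorem opSqrt_one : opSqrt (1 : L2 ι →L[ℂ] L2 ι) = 1 := CFC.sqrt_one

theorem posTrace_one (hρ : 0 ≤ ρ) : posTrace 1 ρ = ∑' i, quadForm ρ (ket i) := by
  rw [posTrace_eq_right hρ, opSqrt_one]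
  rfl

theorem posTrace_one_eq_hsSq (ρ : L2 ι →L[ℂ] L2 ι) : posTrace 1 ρ = hsSq (opSqrt ρ) := by
  rw [posTrace, opSqrt_one, one_mul]

theorem enorm_le_posTrace_one (hρ : 0 ≤ ρ) : ‖ρ‖ₑ ≤ posTrace 1 ρ := by
  rw [posTrace_one_eq_hsSq]
  refine le_trans ?_ (enorm_sq_le_hsSq _)
  conv_lhs => rw [← opSqrt_mul_self hρ]
  rw [sq, ← ofReal_norm, ← ofReal_norm, ← ENNReal.ofReal_mul (norm_nonneg _)]
  exact ENNReal.ofReal_le_ofReal (norm_mul_le _ _)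

theorem posTrace_ne_top (h : posTrace 1 ρ ≠ ⊤) (P : L2 ι →L[ℂ] L2 ι) : posTrace P ρ ≠ ⊤ := by
  rw [posTrace_one_eq_hsSq] at h
  exact ne_top_of_le_ne_top (by finiteness) (hsSq_mul_le (opSqrt P) (opSqrt ρ))

/-- The diagonal entries of Pρ need not be nonnegative. They are the terms of the Hilbert-Schmidt
product of √ρ P with √ρ; passing to adjoints keeps the sum and turns the terms into ⟨√ρ e_i | P √ρ
e_i⟩ ≥ 0. -/
theorem hasSum_inner_mul (hP : 0 ≤ P) (hρ : 0 ≤ ρ) (h : posTrace 1 ρ ≠ ⊤) :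
    HasSum (fun i => inner ℂ (ket i) ((P * ρ) (ket i))) ((posTrace P ρ).toReal : ℂ) := by
  have h' := posTrace_ne_top h P
  rw [posTrace_one_eq_hsSq] at h
  have hPs : P.adjoint = P :=
    ((ContinuousLinearMap.nonneg_iff_isPositive _).mp hP).isSelfAdjoint.adjoint_eq
  have hadj : (opSqrt ρ * P).adjoint = P * opSqrt ρ := by
    rw [← ContinuousLinearMap.star_eq_adjoint, star_mul]
    simp only [ContinuousLinearMap.star_eq_adjoint, opSqrt_adjoint, hPs]
  have h1 : hsSq (opSqrt ρ * P) ≠ ⊤ := by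
    rw [← hsSq_adjoint, hadj]
    exact ne_top_of_le_ne_top (by finiteness) (hsSq_mul_le P (opSqrt ρ))
  obtain ⟨s, hs, hs'⟩ := exists_hasSum_inner h1 h
  have e : s = ((posTrace P ρ).toReal : ℂ) := by
    rw [hadj, opSqrt_adjoint] at hs'
    refine hs'.unique ?_
    rw [posTrace_eq_left hP] at h' ⊢
    have h2 := (ENNReal.summable_toReal h').hasSum
    rw [← ENNReal.tsum_toReal_eq (fun i => ENNReal.ne_top_of_tsum_ne_top h' i)] at h2
    refine hasSum_of_eq (fun i => ?_) (Complex.hasSum_ofReal.mpr h2)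
    rw [quadForm, ENNReal.toReal_ofReal (re_inner_nonneg hP _), ← inner_eq_ofReal_re hP]
    rfl
  rw [← e]
  refine hasSum_of_eq (fun i => ?_) hs
  rw [mul_apply_eq_comp, ← ContinuousLinearMap.adjoint_inner_right, hadj,
    mul_apply_eq_comp]
  conv_lhs => rw [← opSqrt_mul_self hρ]
  rfl

end HilbertSchmidt

/-! ### Cylinder extensions and Kraus families. -/

variable {Var : Type u} {type : Var → QType} {B : GlobalBasis type}

/-- The slices split `H_all` into copies of the register space, on each of which the cylinder
extension acts as A. Identities on the register space lift through this. -/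
theorem slice_cylinder (r : Register Var) (A : RegSpace type r →L[ℂ] RegSpace type r)
    (f : B.Space) (c : B.carrier) : slice r (cylinder B r A f) c = A (slice r f c) := by
  apply lp.ext
  funext x
  change A (slice r f (writeReg r x c)) (readReg r (writeReg r x c)) = _
  rw [slice_writeReg, readReg_writeReg]

/-- The basis label `|0⟩` of a register. -/
def Register.zeroLabel (type : Var → QType) (r : Register Var) : r.Label type :=
  fun q => (type q.1).zero

theorem tsum_enorm_slice (r : Register Var) (f : B.Space) :
    ∑' d : {c : B.carrier // readReg r c = r.zeroLabel type}, ‖slice r f d.1‖ₑ ^ 2 =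
      ‖f‖ₑ ^ 2 := by
  have h := hasSum_slice r (r.zeroLabel type) f
  rw [← ofReal_norm_sq, ← h.tsum_eq,
    ENNReal.ofReal_tsum_of_nonneg (fun _ => by positivity) h.summable]
  simp only [ofReal_norm_sq]

theorem hasSum_inner_slice (r : Register Var) (f g : B.Space) :
    HasSum (fun d : {c : B.carrier // readReg r c = r.zeroLabel type} =>
      inner ℂ (slice r f d.1) (slice r g d.1)) (inner ℂ f g) := by
  have h := (splitEquiv B r (r.zeroLabel type)).symm.hasSum_iff.mpr (lp.hasSum_inner (𝕜 := ℂ) f g)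
  exact HasSum.prod_fiberwise h fun d => lp.hasSum_inner (𝕜 := ℂ) (slice r f d.1) (slice r g d.1)

theorem cylinder_adjoint (r : Register Var) (A : RegSpace type r →L[ℂ] RegSpace type r) :
    (cylinder B r A).adjoint = cylinder B r A.adjoint := by
  symm
  rw [ContinuousLinearMap.eq_adjoint_iff]
  intro f g
  refine (hasSum_inner_slice r _ _).unique (hasSum_of_eq (fun d => ?_) (hasSum_inner_slice r _ _))
  rw [slice_cylinder, slice_cylinder, ContinuousLinearMap.adjoint_inner_left]

theorem ketBra_adjoint (q : Var) (x y : (type q).Label) :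
    (ketBra B q x y).adjoint = ketBra B q y x := by
  rw [ketBra, ketBra, cylinder_adjoint, InnerProductSpace.adjoint_rankOne]

/-- The family `K` satisfies `∑ K i† K i = I`. -/
def IsKrausFamily {I H : Type*} [NormedAddCommGroup H] [InnerProductSpace ℂ H]
    (K : I → H →L[ℂ] H) : Prop :=
  ∀ x, ∑' i, ‖K i x‖ₑ ^ 2 = ‖x‖ₑ ^ 2

theorem IsKrausFamily.cylinder {I : Type*} {r : Register Var}
    {K : I → RegSpace type r →L[ℂ] RegSpace type r} (hK : IsKrausFamily K) :
    IsKrausFamily fun i => cylinder B r (K i) := by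
  intro f
  simp only [← tsum_enorm_slice r, slice_cylinder]
  rw [ENNReal.tsum_comm]
  simp only [hK _]

theorem quadForm_one {H : Type*} [NormedAddCommGroup H] [InnerProductSpace ℂ H]
    (x : H) : quadForm 1 x = ‖x‖ₑ ^ 2 := by
  rw [quadForm, one_apply_eq_self, inner_self_eq_norm_sq_to_K, ← ofReal_norm_sq]
  norm_cast

theorem Measurement.isKrausFamily {r : Register Var} {I : Type} (M : Measurement type r I) :
    IsKrausFamily M.op := by
  intro x
  have h : ∀ m, ‖M.op m x‖ₑ ^ 2 = quadForm ((M.op m).adjoint * M.op m) x :=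
    fun m => (quadForm_adjoint_mul_self _ _).symm
  simp only [h]
  rw [quadForm_tsum M.complete, quadForm_one]
  intro m
  simpa using nonneg_conj (zero_le_one (α := RegSpace type r →L[ℂ] RegSpace type r))
    (M.op m).adjoint

theorem isKrausFamily_of_isometry {H : Type*} [NormedAddCommGroup H] [InnerProductSpace ℂ H]
    [CompleteSpace H] {U : H →L[ℂ] H} (hU : U.adjoint * U = 1) :
    IsKrausFamily fun _ : Unit => U := by
  intro x
  rw [tsum_fintype, Finset.sum_const, Finset.card_univ, Fintype.card_unit, one_smul,
    ← quadForm_adjoint_mul_self, ← quadForm_one]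
  exact congrArg (quadForm · x) hU

theorem singleLabel_bijective (q : Var) :
    Function.Bijective (Register.singleLabel (type := type) q) := by
  have hmem : q ∈ (Register.single q).vars := List.mem_singleton_self q
  constructor
  · intro x y h
    exact congrFun h ⟨q, hmem⟩
  · intro f
    refine ⟨f ⟨q, hmem⟩, ?_⟩
    funext ⟨p, hp⟩
    obtain rfl := List.mem_singleton.mp hp
    rfl

theorem isKrausFamily_ketBra (q : Var) :
    IsKrausFamily fun x => ketBra B q (type q).zero x := by
  refine IsKrausFamily.cylinder fun v => ?_
  rw [← tsum_enorm_sq v, ← (Equiv.ofBijective _ (singleLabel_bijective q)).tsum_eq]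
  refine tsum_congr fun x => ?_
  rw [InnerProductSpace.rankOne_apply, enorm_smul, inner_ket, ← ofReal_norm (ket _), norm_ket]
  simp

theorem Predicate.compl_nonneg (P : Predicate B) : 0 ≤ 1 - P.1 := sub_nonneg.mpr P.2.2

theorem quadForm_one_sub {H : Type*} [NormedAddCommGroup H] [InnerProductSpace ℂ H]
    {P : H →L[ℂ] H} (hP : 0 ≤ P) (x : H) : quadForm (1 - P) x = ‖x‖ₑ ^ 2 - quadForm P x := by
  rw [← quadForm_one, quadForm, quadForm, quadForm, ← ENNReal.ofReal_sub _ (re_inner_nonneg hP x)]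
  simp

/-- For each vector x, the forms of K†(1 - P)K and K†PK add up over i to ‖x‖², and the second part
is the form of R. Apply this to x = √ρ e_j and sum over j. -/
theorem posTrace_kraus {I ι : Type*} {K P : I → L2 ι →L[ℂ] L2 ι} (hK : IsKrausFamily K)
    {R ρ : L2 ι →L[ℂ] L2 ι} (hP : ∀ i, 0 ≤ P i) (hP' : ∀ i, P i ≤ 1) (hR : 0 ≤ R) (hR' : R ≤ 1)
    (h : HasStrongSum (fun i => (K i).adjoint * P i * K i) R) (hρ : 0 ≤ ρ) :
    ∑' i, posTrace (1 - P i) (K i * ρ * (K i).adjoint) = posTrace (1 - R) ρ := by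
  have h1 : ∀ i, 0 ≤ 1 - P i := fun i => sub_nonneg.mpr (hP' i)
  have h2 : ∀ i, 0 ≤ (K i).adjoint * (1 - P i) * K i := fun i => by
    simpa using nonneg_conj (h1 i) (K i).adjoint
  have h3 : ∀ i, 0 ≤ (K i).adjoint * P i * K i := fun i => by
    simpa using nonneg_conj (hP i) (K i).adjoint
  simp only [posTrace_conj (h1 _) hρ, posTrace_eq_left (h2 _),
    posTrace_eq_left (sub_nonneg.mpr hR')]
  rw [ENNReal.tsum_comm]
  refine tsum_congr fun j => ?_
  generalize opSqrt ρ (ket j) = x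
  have h4 := quadForm_tsum h h3 x
  have h5 : ∑' i, quadForm ((K i).adjoint * (1 - P i) * K i) x +
      ∑' i, quadForm ((K i).adjoint * P i * K i) x = ‖x‖ₑ ^ 2 := by
    rw [← ENNReal.tsum_add, ← hK x]
    refine tsum_congr fun i => ?_
    rw [quadForm_conj, quadForm_conj, quadForm_one_sub (hP i), tsub_add_cancel_of_le]
    rw [← quadForm_one]
    exact quadForm_mono (hP' i) _
  rw [quadForm_one_sub hR, ← h5, h4,
    ENNReal.add_sub_cancel_right (by simp [quadForm])]

/-! ### Failure weights and the one-step inequality. -/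

/-- The predicate `0`. -/
noncomputable def Predicate.zero (B : GlobalBasis type) : Predicate B := ⟨0, le_rfl, zero_le_one⟩

theorem derivable_zero (S : Program type) :
    Derivable (Predicate.zero B) S (Predicate.zero B) := by
  induction S with
  | skip => exact .skip _
  | init q => exact .init q _ _ fun ψ => by simp [Predicate.zero]
  | unitary r U hU => exact .unitary r U hU _ _ (by simp [Predicate.zero])
  | seq S₁ S₂ h₁ h₂ => exact .seq _ _ _ _ _ h₁ h₂
  | measure r M S h =>
    exact .measure r M S (fun _ => Predicate.zero B) _ _ h
      fun ψ => by simp [Predicate.zero]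
  | loop r M S h => exact .loop r M S _ (Predicate.zero B) _ (by simp [Predicate.zero]) h

/-- All transitions from a configuration. -/
abbrev Transition (B : GlobalBasis type) (S : Program type) (ρ : Op B) : Type (max u 1) :=
  Σ (S' : Option (Program type)) (ρ' : Op B), Step B S ρ S' ρ'

/-- The least weight `tr((1 - P)ρ)` of a precondition `P` of a program for the
postcondition `Q`. -/
noncomputable def failWeight (Q : Predicate B) : Option (Program type) → Op B → ENNReal
  | none, ρ => posTrace (1 - Q.1) ρ
  | some S, ρ => ⨅ (P : Predicate B) (_ : Derivable P S Q), posTrace (1 - P.1) ρ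

theorem failWeight_some_le {P Q : Predicate B} {S : Program type} (h : Derivable P S Q)
    (ρ : Op B) : failWeight Q (some S) ρ ≤ posTrace (1 - P.1) ρ :=
  iInf₂_le P h

theorem posTrace_compl_anti {P P' : Predicate B} (h : P.1 ≤ P'.1) (ρ : Op B) :
    posTrace (1 - P'.1) ρ ≤ posTrace (1 - P.1) ρ :=
  posTrace_mono_left P'.compl_nonneg (sub_le_sub_left h 1) ρ

theorem failWeight_anti {Q Q' : Predicate B} (h : Q'.1 ≤ Q.1) (S : Option (Program type))
    (ρ : Op B) : failWeight Q S ρ ≤ failWeight Q' S ρ := by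
  cases S with
  | none => exact posTrace_compl_anti h ρ
  | some S => exact le_iInf₂ fun P hP => failWeight_some_le (.order S P P Q' Q le_rfl hP h) ρ

/-- This is the rule for composition; when the first program has ended, the intermediate predicate Q
is itself a precondition of the rest. -/
theorem failWeight_after {Q R : Predicate B} {S₂ : Program type} (h : Derivable Q S₂ R)
    (S₁ : Option (Program type)) (ρ : Op B) :
    failWeight R (some (Program.after S₁ S₂)) ρ ≤ failWeight Q S₁ ρ := by
  cases S₁ with
  | none => exact failWeight_some_le h ρ
  | some S₁ => exact le_iInf₂ fun P hP => failWeight_some_le (.seq S₁ S₂ P Q R hP h) ρ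

theorem nonneg_ketBra_conj {ρ : Op B} (hρ : 0 ≤ ρ) (q : Var) (x y : (type q).Label) :
    0 ≤ ketBra B q x y * ρ * ketBra B q y x := by
  have h := nonneg_conj hρ (ketBra B q x y)
  rwa [ketBra_adjoint q x y] at h

theorem posTrace_init {q : Var} {P R : Predicate B}
    (hR : HasStrongSum
      (fun x => ketBra B q x (type q).zero * P.1 * ketBra B q (type q).zero x) R.1)
    {ρ ρ' : Op B} (hρ : 0 ≤ ρ)
    (h : HasSum (fun x => ketBra B q (type q).zero x * ρ * ketBra B q x (type q).zero) ρ') :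
    posTrace (1 - P.1) ρ' = posTrace (1 - R.1) ρ := by
  have hpos := fun x => nonneg_ketBra_conj hρ q (type q).zero x
  have hadj := fun x => ketBra_adjoint (B := B) q (type q).zero x
  rw [← posTrace_tsum_right (HasSum.hasStrongSum h) hpos (nonneg_of_hasSum h hpos)]
  have hk := posTrace_kraus (P := fun _ => P.1) (isKrausFamily_ketBra (B := B) q)
    (fun _ => P.2.1) (fun _ => P.2.2) R.2.1 R.2.2 (by simpa only [hadj] using hR) hρ
  simpa only [hadj] using hk

theorem Step.nonneg {S : Program type} {ρ ρ' : Op B} {S' : Option (Program type)}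
    (h : Step B S ρ S' ρ') (hρ : 0 ≤ ρ) : 0 ≤ ρ' := by
  induction h with
  | skip ρ => exact hρ
  | init q ρ ρ' h =>
    exact nonneg_of_hasSum h fun x => nonneg_ketBra_conj hρ q _ x
  | unitary r U hU ρ => exact nonneg_conj hρ _
  | seq S₁ S₂ ρ S₁' ρ' h ih => exact ih hρ
  | measure r M S ρ m => exact nonneg_conj hρ _
  | loop_zero r M S ρ => exact nonneg_conj hρ _
  | loop_one r M S ρ => exact nonneg_conj hρ _

theorem tsum_transition_le {P Q : Predicate B} {S : Program type} (h : Derivable P S Q)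
    {ρ : Op B} (hρ : 0 ≤ ρ) :
    ∑' s : Transition B S ρ, failWeight Q s.1 s.2.1 ≤ posTrace (1 - P.1) ρ := by
  induction h generalizing ρ with
  | skip P =>
    -- Only an upper bound is needed, so in every case it suffices to list the transitions by a
    -- surjection.
    have hs : Function.Surjective
        (fun _ : Unit => (⟨none, ρ, Step.skip ρ⟩ : Transition B .skip ρ)) := by
      rintro ⟨_, _, h⟩
      cases h
      exact ⟨(), rfl⟩
    refine (ENNReal.tsum_le_tsum_comp_of_surjective hs _).trans ?_
    simp [failWeight]
  | init q P R hR =>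
    -- For merely positive ρ convergence of the sum is not known here; if it diverges there is no
    -- transition and the left side is 0.
    by_cases he : ∃ ρ', HasSum
        (fun x => ketBra B q (type q).zero x * ρ * ketBra B q x (type q).zero) ρ'
    · obtain ⟨ρ', hρ'⟩ := he
      have hs : Function.Surjective
          (fun _ : Unit => (⟨none, ρ', Step.init q ρ ρ' hρ'⟩ : Transition B (.init q) ρ)) := by
        rintro ⟨_, _, h⟩
        cases h with
        | init _ _ ρ'' h =>
          obtain rfl := hρ'.unique h
          exact ⟨(), rfl⟩
      refine (ENNReal.tsum_le_tsum_comp_of_surjective hs _).trans ?_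
      simp only [failWeight, tsum_fintype, Finset.univ_unique, Finset.sum_singleton]
      exact (posTrace_init hR hρ hρ').le
    · have : IsEmpty (Transition B (.init q) ρ) := ⟨by
        rintro ⟨_, _, h⟩
        cases h with
        | init _ _ ρ'' h => exact he ⟨_, h⟩⟩
      simp
  | unitary r U hU P R hR =>
    have hs : Function.Surjective (fun _ : Unit =>
        (⟨none, _, Step.unitary r U hU ρ⟩ : Transition B (.unitary r U hU) ρ)) := by
      rintro ⟨_, _, h⟩
      cases h
      exact ⟨(), rfl⟩
    refine (ENNReal.tsum_le_tsum_comp_of_surjective hs _).trans ?_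
    refine (posTrace_kraus (P := fun _ => P.1)
      (IsKrausFamily.cylinder (B := B) (isKrausFamily_of_isometry hU)) (fun _ => P.2.1)
      (fun _ => P.2.2) R.2.1 R.2.2 (fun ψ => ?_) hρ).le
    rw [hR]
    exact hasSum_unique _
  | seq S₁ S₂ P Q R h₁ h₂ ih₁ ih₂ =>
    have hs : Function.Surjective (fun s : Transition B S₁ ρ =>
        (⟨some (Program.after s.1 S₂), s.2.1, Step.seq S₁ S₂ ρ s.1 s.2.1 s.2.2⟩ :
          Transition B (.seq S₁ S₂) ρ)) := by
      rintro ⟨_, _, h⟩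
      cases h with
      | seq _ _ _ S₁' _ h => exact ⟨⟨S₁', _, h⟩, rfl⟩
    refine (ENNReal.tsum_le_tsum_comp_of_surjective hs _).trans (le_trans ?_ (ih₁ hρ))
    exact ENNReal.tsum_le_tsum fun s => failWeight_after h₂ _ _
  | measure r M S P Q R h hR ih =>
    have hs : Function.Surjective (fun m =>
        (⟨some (S m), _, Step.measure r M S ρ m⟩ : Transition B (.measure r M S) ρ)) := by
      rintro ⟨_, _, h⟩
      cases h with
      | measure _ _ _ _ m => exact ⟨m, rfl⟩
    refine (ENNReal.tsum_le_tsum_comp_of_surjective hs _).trans ?_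
    refine (ENNReal.tsum_le_tsum fun m => failWeight_some_le (h m) _).trans ?_
    exact (posTrace_kraus (M.isKrausFamily.cylinder (B := B)) (fun m => (P m).2.1)
      (fun m => (P m).2.2) R.2.1 R.2.2 hR hρ).le
  | loop r M S P Q R hR h ih =>
    let next : Fin 2 → Transition B (.loop r M S) ρ :=
      ![⟨none, _, Step.loop_zero r M S ρ⟩, ⟨_, _, Step.loop_one r M S ρ⟩]
    have hs : Function.Surjective next := by
      rintro ⟨_, _, h⟩
      cases h with
      | loop_zero => exact ⟨0, rfl⟩
      | loop_one => exact ⟨1, rfl⟩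
    refine (ENNReal.tsum_le_tsum_comp_of_surjective hs _).trans ?_
    have hk := posTrace_kraus (P := fun i => (![P, Q] i).1) (R := R.1)
      (M.isKrausFamily.cylinder (B := B))
      (fun i => (![P, Q] i).2.1) (fun i => (![P, Q] i).2.2) R.2.1 R.2.2 (fun ψ => ?_) hρ
    · rw [← hk, tsum_fintype, tsum_fintype, Fin.sum_univ_two, Fin.sum_univ_two]
      -- After outcome 1 the body is followed by the loop; the formula for the loop itself, composed
      -- with the premise, gives this program the precondition Q.
      exact add_le_add le_rfl (failWeight_some_le (.seq _ _ _ _ _ h (.loop r M S P Q R hR h)) _)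
    · have h2 := hasSum_fintype fun i =>
        ((cylinder B r (M.op i)).adjoint * (![P, Q] i).1 * cylinder B r (M.op i)) ψ
      rw [hR]
      rwa [Fin.sum_univ_two] at h2
  | order S P P' Q' Q hP h hQ ih =>
    exact (ENNReal.tsum_le_tsum fun s => failWeight_anti hQ _ _).trans
      ((ih hρ).trans (posTrace_compl_anti hP ρ))

/-! ### Summation over terminating computations. -/

/-- The number of transitions of a computation. -/
def Run.length {S : Option (Program type)} {ρ σ : Op B} : Run B S ρ σ → ℕ
  | .done _ => 0
  | .step _ _ _ _ _ _ t => t.length + 1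

theorem Run.nonneg {S : Option (Program type)} {ρ σ : Op B} (t : Run B S ρ σ) (hρ : 0 ≤ ρ) :
    0 ≤ σ := by
  induction t with
  | done ρ => exact hρ
  | step S ρ S' ρ' σ h t ih => exact ih (h.nonneg hρ)

/-- All terminating computations from a configuration. -/
abbrev Runs (B : GlobalBasis type) (S : Option (Program type)) (ρ : Op B) : Type (max u 1) :=
  Σ σ : Op B, Run B S ρ σ

theorem tsum_runs_le (Q : Predicate B) (n : ℕ) (S : Option (Program type)) {ρ : Op B}
    (hρ : 0 ≤ ρ) :
    ∑' t : Runs B S ρ, (if t.2.length < n then posTrace (1 - Q.1) t.1 else 0) ≤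
      failWeight Q S ρ := by
  induction n generalizing S ρ with
  | zero => simp
  | succ n ih =>
    cases S with
    | none =>
      have hs : Function.Surjective
          (fun _ : Unit => (⟨ρ, Run.done ρ⟩ : Runs B none ρ)) := by
        rintro ⟨_, t⟩
        cases t
        exact ⟨(), rfl⟩
      refine (ENNReal.tsum_le_tsum_comp_of_surjective hs _).trans ?_
      simp [failWeight, Run.length]
    | some S =>
      have hs : Function.Surjective (fun p : Σ s : Transition B S ρ, Runs B s.1 s.2.1 =>
          (⟨p.2.1, Run.step S ρ p.1.1 p.1.2.1 p.2.1 p.1.2.2 p.2.2⟩ : Runs B (some S) ρ)) := by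
        rintro ⟨_, t⟩
        cases t with
        | step _ _ S' ρ' _ h t => exact ⟨⟨⟨S', ρ', h⟩, ⟨_, t⟩⟩, rfl⟩
      refine (ENNReal.tsum_le_tsum_comp_of_surjective hs _).trans ?_
      simp only [Run.length, add_lt_add_iff_right]
      rw [ENNReal.tsum_sigma']
      refine (ENNReal.tsum_le_tsum fun s : Transition B S ρ => ih s.1 (s.2.2.nonneg hρ)).trans ?_
      -- The one-step inequality holds for every derivable precondition, hence for the infimum.
      exact le_iInf₂ fun P hP => tsum_transition_le hP hρ

theorem tsum_computation_le {P Q : Predicate B} {S : Program type} (h : Derivable P S Q)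
    {ρ : Op B} (hρ : 0 ≤ ρ) :
    ∑' c : Computation S ρ, posTrace (1 - Q.1) c.1 ≤ posTrace (1 - P.1) ρ := by
  rw [ENNReal.tsum_eq_iSup_sum]
  refine iSup_le fun s => le_trans ?_ (failWeight_some_le h ρ)
  -- Finite partial sums suffice, and a finite set of computations has a maximal length n; the
  -- truncation is strict, hence n + 1.
  let n := s.sup fun c => c.2.length
  refine le_trans (le_of_eq ?_)
    ((ENNReal.sum_le_tsum s).trans (tsum_runs_le Q (n + 1) (some S) hρ))
  refine Finset.sum_congr rfl fun c hc => ?_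
  rw [if_pos (Nat.lt_succ_of_le (Finset.le_sup (f := fun c => c.2.length) hc))]

theorem tsum_computation_one_le (S : Program type) {ρ : Op B} (hρ : 0 ≤ ρ) :
    ∑' c : Computation S ρ, posTrace 1 c.1 ≤ posTrace 1 ρ := by
  simpa [Predicate.zero] using tsum_computation_le (derivable_zero (B := B) S) hρ

/-! ### Return to complex traces and to the denotational semantics. -/

theorem IsPartialDensity.nonneg {ρ : Op B} (h : IsPartialDensity ρ) : 0 ≤ ρ :=
  (ContinuousLinearMap.nonneg_iff_isPositive ρ).mpr h.isPositive

theorem trace_mul_eq {P ρ : Op B} (hP : 0 ≤ P) (hρ : 0 ≤ ρ) (h : posTrace 1 ρ ≠ ⊤) :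
    trace (P * ρ) = ((posTrace P ρ).toReal : ℂ) :=
  (hasSum_inner_mul hP hρ h).tsum_eq

theorem trace_eq {ρ : Op B} (hρ : 0 ≤ ρ) (h : posTrace 1 ρ ≠ ⊤) :
    trace ρ = ((posTrace 1 ρ).toReal : ℂ) := by
  simpa using trace_mul_eq zero_le_one hρ h

theorem isPartialDensity_iff {ρ : Op B} (hρ : 0 ≤ ρ) :
    IsPartialDensity ρ ↔ posTrace 1 ρ ≤ 1 := by
  constructor
  · intro h
    -- A divergent `tsum` is 0, so the bound on `trace` says nothing until finiteness is obtained
    -- from summability.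
    have h1 : posTrace 1 ρ ≠ ⊤ := by
      rw [posTrace_one hρ]
      have h2 := (Complex.hasSum_re h.summable.hasSum).summable
      have h3 := ENNReal.ofReal_tsum_of_nonneg (fun i => re_inner_nonneg hρ (ket i)) h2
      simp only [quadForm, ← h3]
      exact ENNReal.ofReal_ne_top
    have h4 := h.trace_le_one
    rw [trace_eq hρ h1] at h4
    rw [← ENNReal.ofReal_toReal h1, ← ENNReal.ofReal_one]
    exact ENNReal.ofReal_le_ofReal (by exact_mod_cast h4)
  · intro h
    have h1 : posTrace 1 ρ ≠ ⊤ := ne_top_of_le_ne_top ENNReal.one_ne_top h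
    refine ⟨(ContinuousLinearMap.nonneg_iff_isPositive ρ).mp hρ, ?_, ?_⟩
    · simpa using (hasSum_inner_mul zero_le_one hρ h1).summable
    · rw [trace_eq hρ h1]
      have h2 := ENNReal.toReal_mono ENNReal.one_ne_top h
      exact_mod_cast h2

theorem Computation.nonneg {S : Program type} {ρ : Op B} (c : Computation S ρ) (hρ : 0 ≤ ρ) :
    0 ≤ c.1 :=
  c.2.nonneg hρ

/-- The operator norm of a positive operator is at most its trace, and the traces of the results
have a finite sum. -/
theorem summable_computation (S : Program type) {ρ : Op B} (hρ : 0 ≤ ρ)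
    (h : posTrace 1 ρ ≠ ⊤) : Summable fun c : Computation S ρ => c.1 := by
  have h1 : ∑' c : Computation S ρ, ‖c.1‖ₑ ≠ ⊤ := ne_top_of_le_ne_top h
    ((ENNReal.tsum_le_tsum fun c => enorm_le_posTrace_one (c.nonneg hρ)).trans
      (tsum_computation_one_le S hρ))
  refine Summable.of_norm ?_
  simpa using ENNReal.summable_toReal h1

theorem posTrace_denote (S : Program type) {ρ : Op B} (hρ : 0 ≤ ρ) (h : posTrace 1 ρ ≠ ⊤)
    (P : Op B) : 0 ≤ denote S ρ ∧
      posTrace P (denote S ρ) = ∑' c : Computation S ρ, posTrace P c.1 := by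
  have hs := (summable_computation S hρ h).hasSum
  have h0 := nonneg_of_hasSum hs fun c => c.nonneg hρ
  exact ⟨h0, (posTrace_tsum_right (HasSum.hasStrongSum hs) (fun c => c.nonneg hρ) h0 P).symm⟩

theorem posTrace_add_compl (P : Predicate B) (ρ : Op B) :
    posTrace P.1 ρ + posTrace (1 - P.1) ρ = posTrace 1 ρ := by
  rw [posTrace_eq_left P.2.1, posTrace_eq_left P.compl_nonneg, posTrace_eq_left zero_le_one,
    ← ENNReal.tsum_add]
  refine tsum_congr fun i => ?_
  rw [quadForm_one_sub P.2.1, quadForm_one, add_tsub_cancel_of_le]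
  rw [← quadForm_one]
  exact quadForm_mono P.2.2 _

end QWhile

theorem mainTheorem3 {Var : Type u} {type : Var → QWhile.QType} (B : QWhile.GlobalBasis type)
    (S : QWhile.Program type) (P Q : QWhile.Predicate B) (h : QWhile.Derivable P S Q) :
    (∀ ρ : QWhile.Op B, QWhile.IsPartialDensity ρ →
      Summable (fun c : QWhile.Computation S ρ => c.1) ∧
        QWhile.IsPartialDensity (QWhile.denote S ρ)) ∧
      QWhile.PartiallyCorrect P S Q := by
  have hdens : ∀ ρ : QWhile.Op B, QWhile.IsPartialDensity ρ →
      Summable (fun c : QWhile.Computation S ρ => c.1) ∧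
        QWhile.IsPartialDensity (QWhile.denote S ρ) := by
    intro ρ hρ
    have h1 := (QWhile.isPartialDensity_iff hρ.nonneg).mp hρ
    have hfin := ne_top_of_le_ne_top ENNReal.one_ne_top h1
    obtain ⟨h0, h2⟩ := QWhile.posTrace_denote S hρ.nonneg hfin 1
    refine ⟨QWhile.summable_computation S hρ.nonneg hfin, (QWhile.isPartialDensity_iff h0).mpr ?_⟩
    rw [h2]
    exact (QWhile.tsum_computation_one_le S hρ.nonneg).trans h1
  refine ⟨hdens, fun ρ hρ => ?_⟩
  have hfin := ne_top_of_le_ne_top ENNReal.one_ne_top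
    ((QWhile.isPartialDensity_iff hρ.nonneg).mp hρ)
  have hD := (hdens ρ hρ).2
  have hfin' := ne_top_of_le_ne_top ENNReal.one_ne_top
    ((QWhile.isPartialDensity_iff hD.nonneg).mp hD)
  rw [QWhile.trace_mul_eq P.2.1 hρ.nonneg hfin, QWhile.trace_mul_eq Q.2.1 hD.nonneg hfin',
    QWhile.trace_eq hρ.nonneg hfin, QWhile.trace_eq hD.nonneg hfin']
  -- The inequality between failure weights; all traces are finite, so it can be rearranged in ℝ
  -- using the splittings of tr ρ and tr ⟦S⟧ρ by P and Q.
  have key := QWhile.tsum_computation_le h hρ.nonneg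
  rw [← (QWhile.posTrace_denote S hρ.nonneg hfin _).2] at key
  have k1 := ENNReal.toReal_mono (QWhile.posTrace_ne_top hfin _) key
  have k2 := congrArg ENNReal.toReal (QWhile.posTrace_add_compl P ρ)
  have k3 := congrArg ENNReal.toReal (QWhile.posTrace_add_compl Q (QWhile.denote S ρ))
  rw [ENNReal.toReal_add (QWhile.posTrace_ne_top hfin _) (QWhile.posTrace_ne_top hfin _)] at k2
  rw [ENNReal.toReal_add (QWhile.posTrace_ne_top hfin' _) (QWhile.posTrace_ne_top hfin' _)] at k3
  have k4 : (QWhile.posTrace P.1 ρ).toReal ≤ (QWhile.posTrace Q.1 (QWhile.denote S ρ)).toReal +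
      ((QWhile.posTrace 1 ρ).toReal - (QWhile.posTrace 1 (QWhile.denote S ρ)).toReal) := by
    linarith
  exact_mod_cast k4
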